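/- Let $R$ be the hyperfinite factor of type $\mathrm{II}_1$ with trace $\tau$. For an ultrafilter $\omega$ on $\mathbb N$ let $R^\omega$ be the tracial ultrapower, i.e. the $*$-algebra of bounded sequences in $R$ modulo the ideal of those $(x_n)_n$ with $\lim_{n\to\omega}\tau(x_n^*x_n)^{1/2}=0$, with trace $\tau([(x_n)_n])=\lim_{n\to\omega}\tau(x_n)$ and unitary group $U(R^\omega)$. A central pair $(G,\varphi)$ consists of a group $G$ and a positive definite function $\varphi:G\to\mathbb C$ that is constant on conjugacy classes and satisfies $\varphi(e)=1$. It is called hyperlinear if there are a free ultrafilter $\omega$ on $\mathbb N$ and a group homomorphism $\theta:G\to U(R^{\omega})$ such that $\tau(\theta(g))=\varphi(g)$ for all $g\in G$. For a sequence $(G_n,\varphi_n)_{n\in\mathbb N}$ of central pairs and an ultrafilter $\omega$ on $\mathbb N$, the ultraproduct is the central pair $$\Pi_\omega(G_n,\varphi_n)=\Bigl(\prod_n G_n/N,\ \lim_{\omega}\varphi_n\Bigr),\qquad N=\Bigl\{(g_n)_n\in\prod_n G_n:\ \lim_{n\to\omega}\varphi_n(g_n)=1\Bigr\}.$$ **Proposition.**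 If $(G_n,\varphi_n)_{n\in\mathbb N}$ is a sequence of hyperlinear pairs and $\omega$ is an ultrafilter on $\mathbb N$, then $\Pi_\omega(G_n,\varphi_n)$ is a hyperlinear pair. -/

import Mathlib

open Filter Topology
open scoped ComplexOrder ENNReal

universe u

/-! ## Tracial states and tracial ultrapowers -/

section Ultrapower

/-- A tracial state `τ` on a unital C*-algebra `A`. -/
structure TracialState (A : Type*) [CStarAlgebra A] where
  /-- The underlying bounded linear functional. -/
  toCLM : A →L[ℂ] ℂ
  map_one : toCLM 1 = 1
  nonneg : ∀ x, 0 ≤ toCLM (star x * x)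
  trace_comm : ∀ x y, toCLM (x * y) = toCLM (y * x)

namespace TracialState

variable {A : Type*} [CStarAlgebra A] (τ : TracialState A)

noncomputable instance : CoeFun (TracialState A) (fun _ => A → ℂ) := ⟨fun τ => τ.toCLM⟩

/-- The `2`-norm `‖x‖₂ = τ(x* x)^{1/2}`. -/
noncomputable def norm₂ (x : A) : ℝ := Real.sqrt (τ (star x * x)).re

theorem conj_symm (x y : A) : star (τ (star y * x)) = τ (star x * y) := by
  have im0 : ∀ z, (τ (star z * z)).im = 0 := fun z => ((Complex.le_def.1 (τ.nonneg z)).2).symm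
  have h1 := im0 (x + y)
  have h2 := im0 (x + Complex.I • y)
  have hx := im0 x
  have hy := im0 y
  simp only [star_add, star_smul, add_mul, mul_add, smul_mul_assoc, mul_smul_comm, map_add,
    map_smul, Complex.add_im, smul_eq_mul, Complex.mul_im, Complex.mul_re, Complex.star_def, Complex.conj_I,
    Complex.neg_re, Complex.neg_im, Complex.I_re, Complex.I_im] at h1 h2
  apply Complex.ext
  · simp only [Complex.star_def, Complex.conj_re]; linarith
  · simp only [Complex.star_def, Complex.conj_im]; linarith

theorem cauchy_schwarz (x y : A) : ‖τ (star x * y)‖ ≤ τ.norm₂ x * τ.norm₂ y := by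
  let c : PreInnerProductSpace.Core ℂ A :=
    { inner := fun x y => τ (star x * y)
      conj_inner_symm := fun x y => τ.conj_symm x y
      re_inner_nonneg := fun x => (Complex.le_def.1 (τ.nonneg x)).1
      add_left := fun x y z => by simp [add_mul]
      smul_left := fun x y r => by simp }
  exact @InnerProductSpace.Core.norm_inner_le_norm ℂ A _ _ _ c x y

theorem norm₂_nonneg (x : A) : 0 ≤ τ.norm₂ x := Real.sqrt_nonneg _

theorem norm₂_sq (x : A) : ((τ.norm₂ x ^ 2 : ℝ) : ℂ) = τ (star x * x) := by
  have h := Complex.le_def.1 (τ.nonneg x)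
  rw [norm₂, Real.sq_sqrt h.1]
  apply Complex.ext <;> simp [h.2.symm]

theorem norm₂_star (x : A) : τ.norm₂ (star x) = τ.norm₂ x := by
  rw [norm₂, norm₂, star_star, τ.trace_comm]

theorem norm₂_add_le (x y : A) : τ.norm₂ (x + y) ≤ τ.norm₂ x + τ.norm₂ y := by
  apply abs_le_of_sq_le_sq' _ (add_nonneg (τ.norm₂_nonneg x) (τ.norm₂_nonneg y)) |>.2
  have h : (τ.norm₂ (x + y) ^ 2) = τ.norm₂ x ^ 2 + τ.norm₂ y ^ 2 + 2 * (τ (star x * y)).re := by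
    have h1 := congrArg Complex.re (τ.norm₂_sq (x + y))
    have h2 := congrArg Complex.re (τ.norm₂_sq x)
    have h3 := congrArg Complex.re (τ.norm₂_sq y)
    have h4 := congrArg Complex.re (τ.conj_symm x y)
    simp only [star_add, add_mul, mul_add, map_add, Complex.add_re, Complex.ofReal_re,
      Complex.star_def, Complex.conj_re] at h1 h2 h3 h4
    linarith
  have h5 := (Complex.re_le_norm _).trans (τ.cauchy_schwarz x y)
  nlinarith

/-- A crude bound that suffices for the ideal property below. -/
theorem norm₂_mul_sq_le (a x : A) :
    τ.norm₂ (a * x) ^ 2 ≤ τ.norm₂ x * Real.sqrt (‖τ.toCLM‖ * (‖a‖ * ‖a‖ * ‖x‖) ^ 2) := by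
  have h1 : τ (star (a * x) * (a * x)) = τ (star x * (star a * a * x)) := by
    simp [mul_assoc]
  have h2 : ‖star a * a * x‖ ≤ ‖a‖ * ‖a‖ * ‖x‖ := by
    refine (norm_mul_le _ _).trans ?_
    gcongr
    refine (norm_mul_le _ _).trans ?_
    rw [norm_star]
  have h3 : τ.norm₂ (star a * a * x) ≤ Real.sqrt (‖τ.toCLM‖ * (‖a‖ * ‖a‖ * ‖x‖) ^ 2) := by
    apply Real.sqrt_le_sqrt
    refine (Complex.re_le_norm _).trans ((τ.toCLM.le_opNorm _).trans ?_)
    gcongr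
    refine (norm_mul_le _ _).trans ?_
    rw [norm_star, sq]
    gcongr
  calc τ.norm₂ (a * x) ^ 2 = ‖((τ.norm₂ (a * x) ^ 2 : ℝ) : ℂ)‖ := by
        rw [Complex.norm_real, Real.norm_of_nonneg (sq_nonneg _)]
    _ = ‖τ (star x * (star a * a * x))‖ := by rw [τ.norm₂_sq, h1]
    _ ≤ τ.norm₂ x * τ.norm₂ (star a * a * x) := τ.cauchy_schwarz _ _
    _ ≤ _ := by gcongr; exact τ.norm₂_nonneg x

variable [Nontrivial A] (ω : Ultrafilter ℕ)

/-- The ideal of bounded sequences whose `2`-norms tend to `0` along `ω`. -/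
def nullIdeal : Ideal (lp (fun _ : ℕ => A) ∞) where
  carrier := {x | Tendsto (fun n => τ.norm₂ (x n)) ω (𝓝 0)}
  zero_mem' := by
    simp [norm₂]
  add_mem' {x y} hx hy := by
    have h := hx.add hy
    rw [add_zero] at h
    exact squeeze_zero (fun n => τ.norm₂_nonneg _) (fun n => τ.norm₂_add_le _ _) h
  smul_mem' a x hx := by
    have hb : ∀ n, τ.norm₂ (a n * x n) ^ 2
        ≤ τ.norm₂ (x n) * Real.sqrt (‖τ.toCLM‖ * (‖a‖ * ‖a‖ * ‖x‖) ^ 2) := fun n => by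
      refine (τ.norm₂_mul_sq_le _ _).trans ?_
      have ha := lp.norm_apply_le_norm ENNReal.top_ne_zero a n
      have hx' := lp.norm_apply_le_norm ENNReal.top_ne_zero x n
      have := τ.norm₂_nonneg (x n)
      gcongr
    have h := (hx.mul_const (Real.sqrt (‖τ.toCLM‖ * (‖a‖ * ‖a‖ * ‖x‖) ^ 2)))
    rw [zero_mul] at h
    have h2 := (squeeze_zero (fun n => sq_nonneg _) hb h).sqrt
    simp only [Real.sqrt_zero, Real.sqrt_sq (τ.norm₂_nonneg _)] at h2
    exact h2

theorem mem_nullIdeal {x : lp (fun _ : ℕ => A) ∞} :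
    x ∈ τ.nullIdeal ω ↔ Tendsto (fun n => τ.norm₂ (x n)) ω (𝓝 0) := Iff.rfl

theorem star_mem_nullIdeal {x : lp (fun _ : ℕ => A) ∞} (hx : x ∈ τ.nullIdeal ω) :
    star x ∈ τ.nullIdeal ω := by
  rw [mem_nullIdeal] at hx ⊢
  simpa [norm₂_star] using hx

instance : (τ.nullIdeal ω).IsTwoSided where
  mul_mem_of_left {x} y hx := by
    have h := (τ.nullIdeal ω).mul_mem_left (star y) (τ.star_mem_nullIdeal ω hx)
    simpa using τ.star_mem_nullIdeal ω h

/-- The tracial ultrapower `A^ω`: bounded sequences modulo those that tend to `0` in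
`2`-norm along `ω`. -/
def Ultrapower : Type _ := lp (fun _ : ℕ => A) ∞ ⧸ τ.nullIdeal ω

namespace Ultrapower

noncomputable instance : Ring (τ.Ultrapower ω) :=
  inferInstanceAs (Ring (lp (fun _ : ℕ => A) ∞ ⧸ τ.nullIdeal ω))

noncomputable instance : Algebra ℂ (τ.Ultrapower ω) :=
  inferInstanceAs (Algebra ℂ (lp (fun _ : ℕ => A) ∞ ⧸ τ.nullIdeal ω))

/-- The class of a bounded sequence. -/
noncomputable def mk : lp (fun _ : ℕ => A) ∞ →ₐ[ℂ] τ.Ultrapower ω :=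
  Ideal.Quotient.mkₐ ℂ (τ.nullIdeal ω)

theorem mk_surjective : Function.Surjective (mk τ ω) :=
  Ideal.Quotient.mk_surjective

theorem mk_eq_mk_iff {x y : lp (fun _ : ℕ => A) ∞} :
    mk τ ω x = mk τ ω y ↔ Tendsto (fun n => τ.norm₂ (x n - y n)) ω (𝓝 0) :=
  (Ideal.Quotient.mk_eq_mk_iff_sub_mem x y).trans Iff.rfl

/-- The involution `[(xₙ)]* = [(xₙ*)]`. -/
noncomputable instance : StarRing (τ.Ultrapower ω) where
  star := Quotient.map' star (by
    intro x y h
    rw [Submodule.quotientRel_def] at h ⊢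
    simpa using τ.star_mem_nullIdeal ω h)
  star_involutive := by
    intro a
    obtain ⟨x, rfl⟩ := mk_surjective τ ω a
    exact congrArg (mk τ ω) (star_star x)
  star_mul := by
    intro a b
    obtain ⟨x, rfl⟩ := mk_surjective τ ω a
    obtain ⟨y, rfl⟩ := mk_surjective τ ω b
    exact congrArg (mk τ ω) (star_mul x y)
  star_add := by
    intro a b
    obtain ⟨x, rfl⟩ := mk_surjective τ ω a
    obtain ⟨y, rfl⟩ := mk_surjective τ ω b
    exact congrArg (mk τ ω) (star_add x y)

theorem star_mk (x : lp (fun _ : ℕ => A) ∞) : star (mk τ ω x) = mk τ ω (star x) := rfl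

theorem tendsto_trace_sub {x y : lp (fun _ : ℕ => A) ∞} (h : mk τ ω x = mk τ ω y) :
    Tendsto (fun n => τ (x n) - τ (y n)) ω (𝓝 0) := by
  rw [mk_eq_mk_iff] at h
  refine squeeze_zero_norm (fun n => ?_) (by simpa using h.const_mul (τ.norm₂ 1))
  simpa using τ.cauchy_schwarz 1 (x n - y n)

/-- The trace `τ_ω([(xₙ)]) = lim_{n → ω} τ(xₙ)`. -/
noncomputable def trace (a : τ.Ultrapower ω) : ℂ :=
  Quotient.liftOn' a (fun x => limUnder (ω : Filter ℕ) (fun n => τ (x n))) (by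
    intro x y h
    have h' : mk τ ω x = mk τ ω y := Quotient.sound' h
    have h0 := tendsto_trace_sub τ ω h'
    have key : ∀ c, Tendsto (fun n => τ (x n)) ω (𝓝 c) ↔ Tendsto (fun n => τ (y n)) ω (𝓝 c) := by
      intro c
      constructor
      · intro hc
        simpa using hc.sub h0
      · intro hc
        simpa using hc.add h0
    simp only [limUnder, lim]
    congr 1
    ext c
    exact key c)

theorem trace_mk (x : lp (fun _ : ℕ => A) ∞) :
    trace τ ω (mk τ ω x) = limUnder (ω : Filter ℕ) (fun n => τ (x n)) := rfl

end Ultrapower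

end TracialState

end Ultrapower

/-! ## The hyperfinite factor `R` of type `II₁` -/

section HyperfiniteFactor

namespace VonNeumannAlgebra

variable {H : Type*} [NormedAddCommGroup H] [InnerProductSpace ℂ H] [CompleteSpace H]

theorem isClosed_centralizer (S : Set (H →L[ℂ] H)) : IsClosed S.centralizer := by
  have : S.centralizer = ⋂ s ∈ S, {x | s * x = x * s} := by
    ext x; simp [Set.mem_centralizer_iff]
  rw [this]
  exact isClosed_biInter fun s _ =>
    isClosed_eq (continuous_const.mul continuous_id) (continuous_id.mul continuous_const)

instance (M : VonNeumannAlgebra H) : IsClosed (M.toStarSubalgebra : Set (H →L[ℂ] H)) := by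
  have h : (M.toStarSubalgebra : Set (H →L[ℂ] H)) = Set.centralizer (Set.centralizer M.carrier) :=
    M.centralizer_centralizer'.symm
  rw [h]
  exact isClosed_centralizer _

/-- `M` is a hyperfinite factor of type `II₁` with trace `τ`: `M` has trivial center and infinite
dimension, `τ` is a faithful normal tracial state (normality is stated as continuity for the weak
operator topology on bounded sets), and `M` is generated by an increasing sequence of
finite-dimensional `*`-subalgebras. -/
structure IsHyperfiniteIIOneFactor (M : VonNeumannAlgebra H)
    (τ : TracialState M.toStarSubalgebra) : Prop where
  factor : ∀ x ∈ M, (∀ y ∈ M, x * y = y * x) → ∃ c : ℂ, x = c • 1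
  infinite_dimensional : ¬ FiniteDimensional ℂ M.toStarSubalgebra
  faithful : ∀ x, τ (star x * x) = 0 → x = 0
  normal : ∀ (l : Filter M.toStarSubalgebra) (x : M.toStarSubalgebra) (C : ℝ),
    (∀ᶠ y in l, ‖y‖ ≤ C) →
    (∀ ξ η : H, Tendsto (fun y : M.toStarSubalgebra => inner ℂ ξ ((y : H →L[ℂ] H) η)) l
      (𝓝 (inner ℂ ξ ((x : H →L[ℂ] H) η)))) →
    Tendsto (fun y => τ y) l (𝓝 (τ x))
  hyperfinite : ∃ A : ℕ → StarSubalgebra ℂ (H →L[ℂ] H), Monotone A ∧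
    (∀ n, FiniteDimensional ℂ (A n)) ∧
    Set.centralizer (Set.centralizer (⋃ n, (A n : Set (H →L[ℂ] H)))) = (M : Set (H →L[ℂ] H))

end VonNeumannAlgebra

section GroupVonNeumannAlgebra

/-- The Hilbert space `ℓ²(G)`. -/
abbrev EllTwo (G : Type*) : Type _ := lp (fun _ : G => ℂ) 2

namespace EllTwo

variable {G : Type*}

/-- The unitary operator `f ↦ f ∘ e` of `ℓ²(G)` given by a permutation `e` of `G`. -/
noncomputable def perm (e : Equiv.Perm G) : EllTwo G →L[ℂ] EllTwo G :=
  LinearIsometry.toContinuousLinearMap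
  { toFun := fun f => ⟨fun h => f (e h), by
      have h := (memℓp_gen_iff (p := 2) (by norm_num)).1 (lp.memℓp f)
      exact memℓp_gen (e.summable_iff.2 h)⟩
    map_add' := fun f g => rfl
    map_smul' := fun c f => rfl
    norm_map' := fun f => by
      rw [lp.norm_eq_tsum_rpow (by norm_num), lp.norm_eq_tsum_rpow (by norm_num)]
      congr 1
      exact e.tsum_eq (fun i => ‖f i‖ ^ (2 : ℝ≥0∞).toReal) }

@[simp] theorem perm_apply (e : Equiv.Perm G) (f : EllTwo G) (h : G) : perm e f h = f (e h) := rfl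

theorem perm_mul (e e' : Equiv.Perm G) : perm e * perm e' = perm (e' * e) := rfl

theorem star_perm (e : Equiv.Perm G) : star (perm e) = perm e⁻¹ := by
  rw [ContinuousLinearMap.star_eq_adjoint, eq_comm, ContinuousLinearMap.eq_adjoint_iff]
  intro x y
  rw [lp.inner_eq_tsum, lp.inner_eq_tsum, ← e.tsum_eq]
  simp

/-- The unit vector `δ_g` of `ℓ²(G)`. -/
noncomputable def delta (g : G) : EllTwo G :=
  letI := Classical.decEq G
  lp.single 2 g 1

theorem delta_apply_self (g : G) : delta g g = 1 := by
  classical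
  simp [delta]

theorem delta_apply_ne {g h : G} (hgh : h ≠ g) : delta g h = 0 := by
  classical
  simp [delta, Pi.single_eq_of_ne hgh]

theorem inner_delta (g : G) (f : EllTwo G) : inner ℂ (delta g) f = f g := by
  classical
  rw [delta, lp.inner_single_left]
  simp

theorem norm_delta (g : G) : ‖delta g‖ = 1 := by
  classical
  rw [delta, lp.norm_single (by norm_num)]
  simp

theorem perm_delta (e : Equiv.Perm G) (g : G) : perm e (delta g) = delta (e⁻¹ g) := by
  ext h
  rw [perm_apply]
  by_cases hh : e h = g
  · subst hh
    simp [delta_apply_self]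
  · rw [delta_apply_ne hh, delta_apply_ne]
    rintro rfl
    simp at hh

end EllTwo

open EllTwo

variable (G : Type*) [Group G]

/-- The left regular representation, `(λ(g) f)(h) = f(g⁻¹ h)`. -/
noncomputable def leftRegular (g : G) : EllTwo G →L[ℂ] EllTwo G := perm (Equiv.mulLeft g⁻¹)

/-- The right regular representation, `(ρ(g) f)(h) = f(h g)`. -/
noncomputable def rightRegular (g : G) : EllTwo G →L[ℂ] EllTwo G := perm (Equiv.mulRight g)

/-- The group von Neumann algebra `L(G) = λ(G)''`. -/
noncomputable def groupVonNeumannAlgebra : VonNeumannAlgebra (EllTwo G) where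
  toStarSubalgebra := StarSubalgebra.centralizer ℂ
    (StarSubalgebra.centralizer ℂ (Set.range (leftRegular G)) : Set (EllTwo G →L[ℂ] EllTwo G))
  centralizer_centralizer' := by
    change Set.centralizer (Set.centralizer (SetLike.coe (StarSubalgebra.centralizer ℂ
      (StarSubalgebra.centralizer ℂ (Set.range (leftRegular G)) :
        Set (EllTwo G →L[ℂ] EllTwo G))))) = SetLike.coe (StarSubalgebra.centralizer ℂ
      (StarSubalgebra.centralizer ℂ (Set.range (leftRegular G)) :
        Set (EllTwo G →L[ℂ] EllTwo G)))
    rw [StarSubalgebra.coe_centralizer_centralizer, Set.centralizer_centralizer_centralizer]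

variable {G}

theorem star_leftRegular (g : G) : star (leftRegular G g) = leftRegular G g⁻¹ := by
  rw [leftRegular, star_perm, leftRegular]
  congr 1
  ext x; simp

theorem leftRegular_mul (g h : G) : leftRegular G g * leftRegular G h = leftRegular G (g * h) := by
  rw [leftRegular, leftRegular, perm_mul, leftRegular]
  congr 1
  ext x; simp

theorem coe_groupVonNeumannAlgebra : (groupVonNeumannAlgebra G : Set (EllTwo G →L[ℂ] EllTwo G)) =
    Set.centralizer (Set.centralizer (Set.range (leftRegular G))) := by
  change SetLike.coe (StarSubalgebra.centralizer ℂ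
      (StarSubalgebra.centralizer ℂ (Set.range (leftRegular G)) :
        Set (EllTwo G →L[ℂ] EllTwo G))) = _
  rw [StarSubalgebra.coe_centralizer_centralizer]
  congr 2
  apply Set.union_eq_self_of_subset_right
  rintro x ⟨g, hg⟩
  exact ⟨g⁻¹, by rw [← star_leftRegular, hg, star_star]⟩

theorem leftRegular_mem (g : G) : leftRegular G g ∈ groupVonNeumannAlgebra G := by
  rw [← SetLike.mem_coe, coe_groupVonNeumannAlgebra]
  exact Set.subset_centralizer_centralizer ⟨g, rfl⟩

theorem rightRegular_comm {x : EllTwo G →L[ℂ] EllTwo G} (hx : x ∈ groupVonNeumannAlgebra G)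
    (g : G) : rightRegular G g * x = x * rightRegular G g := by
  rw [← SetLike.mem_coe, coe_groupVonNeumannAlgebra] at hx
  refine hx _ ?_
  rintro _ ⟨h, rfl⟩
  rw [leftRegular, rightRegular, perm_mul, perm_mul]
  congr 1
  ext x; simp [mul_assoc]

theorem leftRegular_delta_one (g : G) : leftRegular G g (delta 1) = delta g := by
  rw [leftRegular, perm_delta]
  congr 1
  simp

theorem rightRegular_delta_one (g : G) : rightRegular G g (delta 1) = delta g⁻¹ := by
  rw [rightRegular, perm_delta]
  congr 1
  simp

section Algebra

variable {x y : EllTwo G →L[ℂ] EllTwo G}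

theorem mem_apply_delta (hx : x ∈ groupVonNeumannAlgebra G) (g h : G) :
    x (delta g) h = x (delta 1) (h * g⁻¹) := by
  have h1 : delta g = rightRegular G g⁻¹ (delta 1) := by rw [rightRegular_delta_one, inv_inv]
  rw [h1, ← mul_apply_eq_comp, ← rightRegular_comm hx]
  rfl

theorem star_apply_delta (hx : x ∈ groupVonNeumannAlgebra G) (g : G) :
    star x (delta 1) g = star (x (delta 1) g⁻¹) := by
  rw [← inner_delta g, ContinuousLinearMap.star_eq_adjoint,
    ContinuousLinearMap.adjoint_inner_right, ← inner_conj_symm, inner_delta,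
    mem_apply_delta hx, one_mul]
  rfl

theorem eq_zero_of_apply_delta (hx : x ∈ groupVonNeumannAlgebra G) (h : x (delta 1) = 0) :
    x = 0 := by
  ext f k
  have hs := star_mem hx
  have h1 : star x (delta k) = 0 := by
    ext j
    rw [mem_apply_delta hs, star_apply_delta hx, h]
    simp
  rw [← inner_delta k, ← ContinuousLinearMap.adjoint_inner_left,
    ← ContinuousLinearMap.star_eq_adjoint, h1]
  simp

theorem trace_mul_eq_tsum (hx : x ∈ groupVonNeumannAlgebra G) :
    inner ℂ (delta 1) ((x * y) (delta 1)) = ∑' g, x (delta 1) g⁻¹ * y (delta 1) g := by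
  rw [mul_apply_eq_comp, ← ContinuousLinearMap.adjoint_inner_left,
    ← ContinuousLinearMap.star_eq_adjoint, lp.inner_eq_tsum]
  refine tsum_congr fun g => ?_
  rw [star_apply_delta hx]
  simp [mul_comm]

end Algebra

/-- The canonical trace `τ(x) = ⟨δ_e, x δ_e⟩` of `L(G)`. -/
noncomputable def groupTrace (G : Type*) [Group G] :
    TracialState (groupVonNeumannAlgebra G).toStarSubalgebra where
  toCLM := LinearMap.mkContinuous
    { toFun := fun x => inner ℂ (delta (1 : G)) ((x : EllTwo G →L[ℂ] EllTwo G) (delta 1))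
      map_add' := fun x y => by simp
      map_smul' := fun c x => by simp } 1 (fun x => by
        refine (norm_inner_le_norm (𝕜 := ℂ) (delta (1 : G))
          ((x : EllTwo G →L[ℂ] EllTwo G) (delta 1))).trans ?_
        rw [norm_delta, one_mul]
        refine (ContinuousLinearMap.le_opNorm _ _).trans ?_
        rw [norm_delta, mul_one, one_mul]
        rfl)
  map_one := by
    change inner ℂ (delta (1 : G)) (delta (1 : G)) = 1
    rw [inner_delta, delta_apply_self]
  nonneg := fun x => by
    change 0 ≤ inner ℂ (delta (1 : G)) ((star x.1 * x.1) (delta 1))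
    rw [mul_apply_eq_comp, ContinuousLinearMap.star_eq_adjoint,
      ContinuousLinearMap.adjoint_inner_right, inner_self_eq_norm_sq_to_K]
    norm_cast
    positivity
  trace_comm := fun x y => by
    change inner ℂ (delta (1 : G)) ((x.1 * y.1) (delta 1)) =
      inner ℂ (delta (1 : G)) ((y.1 * x.1) (delta 1))
    rw [trace_mul_eq_tsum x.2, trace_mul_eq_tsum y.2, ← (Equiv.inv G).tsum_eq]
    refine tsum_congr fun g => ?_
    simp [mul_comm]

theorem groupTrace_apply (x : (groupVonNeumannAlgebra G).toStarSubalgebra) :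
    groupTrace G x = inner ℂ (delta (1 : G)) ((x : EllTwo G →L[ℂ] EllTwo G) (delta 1)) := rfl

end GroupVonNeumannAlgebra

section Finitary

open EllTwo

/-- The group `S_∞` of the permutations of `ℕ` that move only finitely many points. -/
def finitaryPerm : Subgroup (Equiv.Perm ℕ) where
  carrier := {σ | {k | σ k ≠ k}.Finite}
  one_mem' := by simp
  mul_mem' {σ ρ} hσ hρ := by
    refine (Set.Finite.union hσ hρ).subset fun k hk => ?_
    by_contra h
    simp only [Set.mem_union, Set.mem_ofPred_eq, not_or, not_not] at h hk
    exact hk (by rw [Equiv.Perm.mul_apply, h.2, h.1])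
  inv_mem' {σ} hσ := by
    refine Set.Finite.subset hσ fun k hk => ?_
    simp only [Set.mem_ofPred_eq] at hk ⊢
    intro h
    exact hk (by rw [Equiv.Perm.inv_eq_iff_eq, h])

theorem swap_mem_finitaryPerm (a b : ℕ) : Equiv.swap a b ∈ finitaryPerm := by
  refine (Set.toFinite {a, b}).subset fun k hk => ?_
  by_contra h
  simp only [Set.mem_insert_iff, Set.mem_singleton_iff, not_or] at h
  exact hk (Equiv.swap_apply_of_ne_of_ne h.1 h.2)

/-- A square-summable class function on `S_∞` is supported at the identity. -/
theorem apply_eq_zero_of_central (f : EllTwo finitaryPerm)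
    (hf : ∀ g h : finitaryPerm, f (g⁻¹ * h * g) = f h) (σ : finitaryPerm) (hσ : σ ≠ 1) :
    f σ = 0 := by
  obtain ⟨a, ha⟩ : ∃ a, σ.1 a ≠ a := by
    by_contra! h
    exact hσ (Subtype.ext (Equiv.ext h))
  have hs := (memℓp_gen_iff (p := 2) (by norm_num)).1 (lp.memℓp f)
  let s : ℕ → finitaryPerm := fun m => ⟨Equiv.swap (σ.1 a) m, swap_mem_finitaryPerm _ _⟩
  let c : ℕ → finitaryPerm := fun m => (s m)⁻¹ * σ * s m
  have hc : ∀ m, m ≠ a → (c m).1 a = m := fun m hm => by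
    change (Equiv.swap (σ.1 a) m)⁻¹ (σ.1 (Equiv.swap (σ.1 a) m a)) = m
    rw [Equiv.swap_apply_of_ne_of_ne ha.symm hm.symm]
    simp
  have hinj : Set.InjOn c {a}ᶜ := fun m hm n hn h => by
    rw [← hc m hm, ← hc n hn, h]
  have hinj' : Function.Injective (fun m : ({a}ᶜ : Set ℕ) => c m) := fun m n h =>
    Subtype.ext (hinj m.2 n.2 h)
  have h2 := hs.comp_injective hinj'
  have h3 : (fun m : ({a}ᶜ : Set ℕ) => ‖f (c m)‖ ^ (2 : ℝ≥0∞).toReal) =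
      fun _ => ‖f σ‖ ^ (2 : ℝ≥0∞).toReal := by
    funext m
    rw [hf]
  have : Infinite ({a}ᶜ : Set ℕ) := (Set.finite_singleton a).infinite_compl.to_subtype
  have h4 : Summable (fun _ : ({a}ᶜ : Set ℕ) => ‖f σ‖ ^ (2 : ℝ≥0∞).toReal) := h3 ▸ h2
  rw [summable_const_iff] at h4
  simpa using h4

/-- The permutations that fix every `k ≥ n`. -/
def permLT (n : ℕ) : Submonoid finitaryPerm where
  carrier := {σ | ∀ k, n ≤ k → σ.1 k = k}
  one_mem' := fun k _ => rfl
  mul_mem' {σ ρ} hσ hρ := fun k hk => by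
    change σ.1 (ρ.1 k) = k
    rw [hρ k hk, hσ k hk]

theorem inv_mem_permLT {n : ℕ} {σ : finitaryPerm} (h : σ ∈ permLT n) : σ⁻¹ ∈ permLT n :=
  fun k hk => (Equiv.Perm.inv_eq_iff_eq).2 (h k hk).symm

theorem finite_permLT (n : ℕ) : (permLT n : Set finitaryPerm).Finite := by
  have hmaps : ∀ σ ∈ permLT n, ∀ k, k < n → σ.1 k < n := fun σ hσ k hk => by
    by_contra! h
    exact absurd (σ.1.injective (hσ _ h)) (by omega)
  let F : permLT n → (Fin n → Fin n) := fun σ k => ⟨σ.1.1 k, hmaps σ.1 σ.2 k k.2⟩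
  have hF : Function.Injective F := fun σ ρ h => by
    refine Subtype.ext (Subtype.ext (Equiv.ext fun k => ?_))
    by_cases hk : k < n
    · exact congrArg Fin.val (congrFun h ⟨k, hk⟩)
    · rw [σ.2 k (by omega), ρ.2 k (by omega)]
  have := Finite.of_injective F hF
  exact Set.toFinite _

theorem exists_mem_permLT (σ : finitaryPerm) : ∃ n, σ ∈ permLT n := by
  obtain ⟨n, hn⟩ := σ.2.bddAbove
  refine ⟨n + 1, fun k hk => ?_⟩
  by_contra h
  have := hn h
  omega

/-- The linear span of `λ(S_n)`. -/
noncomputable def spanPermLT (n : ℕ) :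
    StarSubalgebra ℂ (EllTwo finitaryPerm →L[ℂ] EllTwo finitaryPerm) :=
  StarAlgebra.adjoin ℂ (leftRegular finitaryPerm '' permLT n)

theorem finiteDimensional_adjoin {B : Type*} [Ring B] [StarRing B] [Algebra ℂ B]
    [StarModule ℂ B] (S : Submonoid B) (hstar : star (S : Set B) ⊆ S) (hfin : (S : Set B).Finite) :
    FiniteDimensional ℂ (StarAlgebra.adjoin ℂ (S : Set B)) := by
  have h : Subalgebra.toSubmodule (StarAlgebra.adjoin ℂ (S : Set B)).toSubalgebra =
      Submodule.span ℂ (S : Set B) := by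
    rw [StarAlgebra.adjoin_toSubalgebra, Set.union_eq_self_of_subset_right hstar,
      Algebra.adjoin_eq_span, Submonoid.closure_eq]
  have := FiniteDimensional.span_of_finite ℂ hfin
  rw [← h] at this
  exact this

theorem finiteDimensional_spanPermLT (n : ℕ) : FiniteDimensional ℂ (spanPermLT n) := by
  let Λ : finitaryPerm →* (EllTwo finitaryPerm →L[ℂ] EllTwo finitaryPerm) :=
    { toFun := leftRegular finitaryPerm
      map_one' := by
        ext f h
        simp [leftRegular]
      map_mul' := fun g h => (leftRegular_mul g h).symm }
  let S : Submonoid (EllTwo finitaryPerm →L[ℂ] EllTwo finitaryPerm) := (permLT n).map Λ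
  have hstar : star (S : Set (EllTwo finitaryPerm →L[ℂ] EllTwo finitaryPerm)) ⊆ S := by
    rintro x ⟨σ, hσ, hx⟩
    refine ⟨σ⁻¹, inv_mem_permLT hσ, ?_⟩
    change leftRegular _ σ = star x at hx
    change leftRegular _ σ⁻¹ = x
    rw [← star_leftRegular, hx, star_star]
  exact finiteDimensional_adjoin S hstar ((finite_permLT n).image _)

/-- The hyperfinite factor `R` of type `II₁`, realized as the group von Neumann algebra of the
(locally finite, i.c.c.) group `S_∞` of finitely supported permutations of `ℕ`; see
`hyperfiniteFactor_spec`. -/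
noncomputable def hyperfiniteFactor : VonNeumannAlgebra (EllTwo finitaryPerm) :=
  groupVonNeumannAlgebra finitaryPerm

/-- The trace of `R`. -/
noncomputable def hyperfiniteTrace : TracialState hyperfiniteFactor.toStarSubalgebra :=
  groupTrace finitaryPerm

instance : Nontrivial hyperfiniteFactor.toStarSubalgebra :=
  ⟨0, 1, fun h => by
    have := congrArg (fun x => hyperfiniteTrace x) h
    simp [hyperfiniteTrace.map_one] at this⟩

/-- `R` is indeed a hyperfinite `II₁` factor, with trace `hyperfiniteTrace`. -/
theorem hyperfiniteFactor_spec :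
    hyperfiniteFactor.IsHyperfiniteIIOneFactor hyperfiniteTrace where
  factor x hx hc := by
    have h1 : ∀ g h : finitaryPerm, x (delta 1) (g⁻¹ * h * g) = x (delta 1) h := fun g h => by
      have e1 : x (delta g) (h * g) = x (delta 1) h := by
        rw [mem_apply_delta hx, mul_inv_cancel_right]
      have e2 : x (delta g) = leftRegular _ g (x (delta 1)) := by
        rw [← leftRegular_delta_one, ← mul_apply_eq_comp, hc _ (leftRegular_mem g)]
        rfl
      rw [← e1, e2, mul_assoc]
      rfl
    refine ⟨x (delta 1) 1, ?_⟩
    rw [← sub_eq_zero]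
    refine eq_zero_of_apply_delta (sub_mem hx ?_) ?_
    · exact (hyperfiniteFactor.toStarSubalgebra).smul_mem (one_mem _) _
    · ext σ
      change x (delta 1) σ - x (delta 1) 1 * delta 1 σ = 0
      by_cases hσ : σ = 1
      · subst hσ
        simp [delta_apply_self]
      · simp [delta_apply_ne hσ, apply_eq_zero_of_central _ h1 σ hσ]
  infinite_dimensional hfin := by
    let u : finitaryPerm → hyperfiniteFactor.toStarSubalgebra := fun g =>
      ⟨leftRegular _ g, leftRegular_mem g⟩
    let E : hyperfiniteFactor.toStarSubalgebra →ₗ[ℂ] EllTwo finitaryPerm :=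
      { toFun := fun x => x.1 (delta 1)
        map_add' := fun _ _ => rfl
        map_smul' := fun _ _ => rfl }
    have ho : Orthonormal ℂ (fun g : finitaryPerm => delta g) := by
      refine ⟨norm_delta, fun g h hgh => ?_⟩
      change inner ℂ (delta g) (delta h) = 0
      rw [inner_delta, delta_apply_ne hgh]
    have hl : LinearIndependent ℂ (E ∘ u) := by
      have : E ∘ u = fun g => delta g := funext fun g => leftRegular_delta_one g
      rw [this]
      exact ho.linearIndependent
    have : Finite finitaryPerm := (LinearIndependent.of_comp E hl).finite
    have hinj : Function.Injective (fun m : ℕ =>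
        (⟨Equiv.swap 0 m, swap_mem_finitaryPerm _ _⟩ : finitaryPerm)) := fun m n h => by
      have := congrArg (fun σ : finitaryPerm => σ.1 0) h
      simpa using this
    exact not_injective_infinite_finite _ hinj
  faithful x h := by
    apply Subtype.ext
    refine eq_zero_of_apply_delta x.2 ?_
    change inner ℂ (delta (1 : finitaryPerm)) ((star x.1 * x.1) (delta 1)) = 0 at h
    rwa [mul_apply_eq_comp, ContinuousLinearMap.star_eq_adjoint,
      ContinuousLinearMap.adjoint_inner_right, inner_self_eq_zero] at h
  normal l x C _ h := h _ _
  hyperfinite := by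
    refine ⟨spanPermLT, fun m n hmn => ?_, finiteDimensional_spanPermLT, ?_⟩
    · exact StarAlgebra.adjoin_mono (Set.image_mono fun σ hσ k hk => hσ k (hmn.trans hk))
    · refine Set.Subset.antisymm ?_ ?_
      · rw [← hyperfiniteFactor.centralizer_centralizer]
        refine Set.centralizer_subset (Set.centralizer_subset (Set.iUnion_subset fun n => ?_))
        have : spanPermLT n ≤ hyperfiniteFactor.toStarSubalgebra := by
          refine StarAlgebra.adjoin_le ?_
          rintro _ ⟨σ, _, rfl⟩
          exact leftRegular_mem σ
        exact this
      · rw [hyperfiniteFactor, coe_groupVonNeumannAlgebra]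
        refine Set.centralizer_subset (Set.centralizer_subset ?_)
        rintro _ ⟨σ, rfl⟩
        obtain ⟨n, hn⟩ := exists_mem_permLT σ
        exact Set.mem_iUnion.2 ⟨n, StarAlgebra.subset_adjoin ℂ _ ⟨σ, hn, rfl⟩⟩

end Finitary

end HyperfiniteFactor

/-! ## Central pairs and their ultraproducts -/

/-- A central pair `(G, φ)`: a group `G` with a positive definite function `φ : G → ℂ` that is
constant on conjugacy classes and satisfies `φ(e) = 1`. -/
structure CentralPair where
  /-- The underlying group. -/
  carrier : Type u
  [group : Group carrier]
  /-- The positive definite function. -/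
  φ : carrier → ℂ
  posDef : ∀ (m : ℕ) (g : Fin m → carrier) (c : Fin m → ℂ),
    0 ≤ ∑ i, ∑ j, star (c i) * c j * φ ((g i)⁻¹ * g j)
  central : ∀ g h, φ (h * g * h⁻¹) = φ g
  map_one : φ 1 = 1

namespace CentralPair

attribute [instance] CentralPair.group

section Basic

variable (P : CentralPair.{u})

theorem φ_inv (g : P.carrier) : P.φ g⁻¹ = star (P.φ g) := by
  have h1 := (Complex.le_def.1 (P.posDef 2 ![1, g] ![1, 1])).2
  have h2 := (Complex.le_def.1 (P.posDef 2 ![1, g] ![1, Complex.I])).2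
  simp [Fin.sum_univ_two, P.map_one] at h1 h2
  apply Complex.ext <;> simp <;> linarith

/-- The Cauchy–Schwarz type inequality for positive definite functions. -/
theorem norm_sub_sq_le (g h : P.carrier) :
    ‖P.φ (g * h) - P.φ h‖ ^ 2 ≤ 2 - 2 * (P.φ g).re := by
  set d := P.φ (g * h) - P.φ h with hd
  have h1 := (Complex.le_def.1 (P.posDef 3 ![g⁻¹, 1, h] ![1, -1, -star d])).1
  have e1 : P.φ (h⁻¹ * g⁻¹) = star (P.φ (g * h)) := by rw [← φ_inv, mul_inv_rev]
  have e2 : P.φ h⁻¹ = star (P.φ h) := P.φ_inv h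
  have e3 : P.φ g⁻¹ = star (P.φ g) := P.φ_inv g
  have hre : d.re = (P.φ (g * h)).re - (P.φ h).re := by simp [hd]
  have him : d.im = (P.φ (g * h)).im - (P.φ h).im := by simp [hd]
  simp [Fin.sum_univ_three, P.map_one, e1, e2, e3] at h1
  rw [← Complex.normSq_eq_norm_sq, Complex.normSq_apply]
  have k1 : (P.φ (g * h)).re = d.re + (P.φ h).re := by linarith
  have k2 : (P.φ (g * h)).im = d.im + (P.φ h).im := by linarith
  rw [k1, k2] at h1
  nlinarith

theorem norm_le_one (g : P.carrier) : ‖P.φ g‖ ≤ 1 := by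
  have h1 := (Complex.le_def.1 (P.posDef 2 ![1, g] ![1, -star (P.φ g)])).1
  have e3 : P.φ g⁻¹ = star (P.φ g) := P.φ_inv g
  simp [Fin.sum_univ_two, P.map_one, e3] at h1
  have : ‖P.φ g‖ ^ 2 ≤ 1 := by
    rw [← Complex.normSq_eq_norm_sq, Complex.normSq_apply]
    nlinarith
  nlinarith [norm_nonneg (P.φ g)]

theorem φ_mul_comm (g h : P.carrier) : P.φ (g * h) = P.φ (h * g) := by
  have := P.central (g * h) h
  rw [← this]
  congr 1
  group

end Basic

variable (P : ℕ → CentralPair.{u}) (ω : Ultrafilter ℕ)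

theorem tendsto_mul_sub {g : ∀ n, (P n).carrier}
    (hg : Tendsto (fun n => (P n).φ (g n)) ω (𝓝 1)) (h : ∀ n, (P n).carrier) :
    Tendsto (fun n => (P n).φ (g n * h n) - (P n).φ (h n)) ω (𝓝 0) := by
  have h1 : Tendsto (fun n => 2 - 2 * ((P n).φ (g n)).re) ω (𝓝 0) := by
    have := (((Complex.continuous_re.tendsto 1).comp hg).const_mul 2).const_sub 2
    simpa using this
  have h2 := (squeeze_zero (fun n => sq_nonneg _)
    (fun n => (P n).norm_sub_sq_le (g n) (h n)) h1).sqrt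
  rw [tendsto_zero_iff_norm_tendsto_zero]
  simpa using h2

/-- The normal subgroup `N = {(gₙ) : lim_{n → ω} φₙ(gₙ) = 1}` of `Πₙ Gₙ`. -/
def nullSubgroup : Subgroup (∀ n, (P n).carrier) where
  carrier := {g | Tendsto (fun n => (P n).φ (g n)) ω (𝓝 1)}
  one_mem' := by
    simp [CentralPair.map_one]
  mul_mem' {g h} hg hh := by
    have := (tendsto_mul_sub P ω hg h).add hh
    simpa using this
  inv_mem' {g} hg := by
    have := (continuous_star.tendsto (1 : ℂ)).comp hg
    simpa [Function.comp_def, φ_inv] using this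

theorem mem_nullSubgroup {g : ∀ n, (P n).carrier} :
    g ∈ nullSubgroup P ω ↔ Tendsto (fun n => (P n).φ (g n)) ω (𝓝 1) := Iff.rfl

instance : (nullSubgroup P ω).Normal where
  conj_mem g hg h := by
    rw [mem_nullSubgroup] at hg ⊢
    simpa [CentralPair.central] using hg

theorem exists_tendsto (g : ∀ n, (P n).carrier) :
    ∃ c, Tendsto (fun n => (P n).φ (g n)) ω (𝓝 c) := by
  have hK := isCompact_closedBall (0 : ℂ) 1
  obtain ⟨c, -, hc⟩ := hK.ultrafilter_le_nhds (ω.map fun n => (P n).φ (g n)) (by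
    rw [le_principal_iff]
    have h : ∀ᶠ n in (ω : Filter ℕ), (P n).φ (g n) ∈ Metric.closedBall (0 : ℂ) 1 :=
      Eventually.of_forall fun n => by simpa using (P n).norm_le_one (g n)
    exact h)
  exact ⟨c, hc⟩

theorem limit_eq_of_mem {g h : ∀ n, (P n).carrier} (hgh : g⁻¹ * h ∈ nullSubgroup P ω) :
    limUnder (ω : Filter ℕ) (fun n => (P n).φ (g n)) =
      limUnder (ω : Filter ℕ) (fun n => (P n).φ (h n)) := by
  obtain ⟨c, hc⟩ := exists_tendsto P ω g
  have h1 := (tendsto_mul_sub P ω hgh g).add hc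
  have h2 : Tendsto (fun n => (P n).φ (h n)) ω (𝓝 c) := by
    have e : ∀ n, (P n).φ ((g⁻¹ * h) n * g n) = (P n).φ (h n) := fun n => by
      rw [φ_mul_comm]
      simp
    simp only [e, zero_add, sub_add_cancel] at h1
    exact h1
  rw [hc.limUnder_eq, h2.limUnder_eq]

/-- The function `lim_ω φₙ` on `(Πₙ Gₙ) / N`. -/
noncomputable def limitFunction (a : (∀ n, (P n).carrier) ⧸ nullSubgroup P ω) : ℂ :=
  Quotient.liftOn' a (fun g => limUnder (ω : Filter ℕ) (fun n => (P n).φ (g n)))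
    (fun _ _ h => limit_eq_of_mem P ω (QuotientGroup.leftRel_apply.1 h))

theorem tendsto_limitFunction (g : ∀ n, (P n).carrier) :
    Tendsto (fun n => (P n).φ (g n)) ω
      (𝓝 (limitFunction P ω (QuotientGroup.mk' (nullSubgroup P ω) g))) := by
  obtain ⟨c, hc⟩ := exists_tendsto P ω g
  exact tendsto_nhds_limUnder ⟨c, hc⟩

/-- The ultraproduct `Π_ω (Gₙ, φₙ) = ((Πₙ Gₙ) / N, lim_ω φₙ)`. -/
noncomputable def ultraproduct : CentralPair.{u} where
  carrier := (∀ n, (P n).carrier) ⧸ nullSubgroup P ω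
  φ := limitFunction P ω
  posDef m g c := by
    choose r hr using fun i => QuotientGroup.mk'_surjective (nullSubgroup P ω) (g i)
    have h : Tendsto (fun n => ∑ i, ∑ j, star (c i) * c j * (P n).φ ((r i n)⁻¹ * r j n)) ω
        (𝓝 (∑ i, ∑ j, star (c i) * c j * limitFunction P ω ((g i)⁻¹ * g j))) := by
      refine tendsto_finsetSum _ fun i _ => tendsto_finsetSum _ fun j _ => ?_
      have := tendsto_limitFunction P ω ((r i)⁻¹ * r j)
      rw [map_mul, map_inv, hr, hr] at this
      exact this.const_mul _
    exact ge_of_tendsto' h fun n => (P n).posDef m (fun i => r i n) c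
  central g h := by
    obtain ⟨g, rfl⟩ := QuotientGroup.mk'_surjective _ g
    obtain ⟨h, rfl⟩ := QuotientGroup.mk'_surjective _ h
    have h1 := tendsto_limitFunction P ω (h * g * h⁻¹)
    have h2 := tendsto_limitFunction P ω g
    simp only [Pi.mul_apply, Pi.inv_apply, CentralPair.central] at h1
    rw [map_mul, map_mul, map_inv] at h1
    exact tendsto_nhds_unique h1 h2
  map_one := by
    have h1 := tendsto_limitFunction P ω 1
    simp only [Pi.one_apply, CentralPair.map_one] at h1
    rw [_root_.map_one] at h1
    exact tendsto_nhds_unique h1 tendsto_const_nhds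

/-- `(G, φ)` is a hyperlinear pair: for some free ultrafilter `ω` on `ℕ` there is a homomorphism
`θ` of `G` into the unitary group of `R^ω` with `τ (θ g) = φ g` for all `g`. -/
def IsHyperlinear (P : CentralPair.{u}) : Prop :=
  ∃ ω : Ultrafilter ℕ, (ω : Filter ℕ) ≤ cofinite ∧
    ∃ θ : P.carrier →* unitary (hyperfiniteTrace.Ultrapower ω),
      ∀ g, TracialState.Ultrapower.trace hyperfiniteTrace ω (θ g) = P.φ g

end CentralPair

/-! Homomorphisms `θ n` into the unitary group of `R^(ν n)` are glued into one homomorphism into the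
unitary group of a single ultrapower. Its ultrafilter is the iterated one, `ω.iterate ν`, on `ℕ × ℕ
≃ ℕ`: a limit along it is the limit over `ω` of the limits along the rows `ν n`. A sequence of
unitaries `u n ∈ R^(ν n)` is lifted row by row and read as one sequence indexed by pairs. Relations
valid in every row pass to the new ultrapower, and its trace is `lim_ω` of the row traces
(`exists_monoidHom_iterate`).

Two points need an argument. The glued sequence must be bounded, so the row lifts need a common
bound; `exists_norm_le_two_mk_eq` provides it by functional calculus. The subgroup `N` must go to
`1`: its elements go to unitaries of trace `1`, and such a unitary `a` satisfies `‖a - 1‖₂² = 2 - 2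
Re τ(a) = 0` (`eq_one_of_trace_eq_one`). -/

/-! ### Functional calculus and iterated limits -/

/-- A continuous substitute for the polar part of `x`: the correction `x - y` vanishes in every
quotient where `star x * x` becomes `1`, while the bound on `y` does not depend on `x`. -/
theorem exists_norm_le_two_sub_eq_mul {B : Type*} [CStarAlgebra B] (x : B) :
    ∃ y c : B, ‖y‖ ≤ 2 ∧ x - y = c * (star x * x - 1) := by
  have hs : IsSelfAdjoint (star x * x) := .star_mul_self x
  have hd : ∀ t : ℝ, 1 + t ^ 2 ≠ 0 := fun t => by positivity
  -- `f 1 = 1`, `t * f t ^ 2` is bounded on all of `ℝ`, and `1 - f t = g t * (t - 1)`. The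
  -- denominator `1 + t ^ 2` avoids any appeal to positivity of the spectrum.
  let f : ℝ → ℝ := fun t => 2 / (1 + t ^ 2)
  let g : ℝ → ℝ := fun t => (t + 1) / (1 + t ^ 2)
  have hf : Continuous f := by fun_prop (disch := exact hd _)
  have hg : Continuous g := by fun_prop (disch := exact hd _)
  refine ⟨x * cfc f (star x * x), x * cfc g (star x * x), ?_, ?_⟩
  · have hstar : star (cfc f (star x * x)) = cfc f (star x * x) :=
      (cfc_predicate f (star x * x)).star_eq
    have e : star (x * cfc f (star x * x)) * (x * cfc f (star x * x)) =
        cfc (fun t => f t * t * f t) (star x * x) := by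
      rw [cfc_mul (fun t => f t * t) f _ (by fun_prop) (by fun_prop),
        cfc_mul f (fun t => t) _ (by fun_prop) (by fun_prop), cfc_id' ℝ (star x * x), star_mul,
        hstar]
      simp only [mul_assoc]
    have h2 : ‖x * cfc f (star x * x)‖ * ‖x * cfc f (star x * x)‖ ≤ 4 := by
      rw [← CStarRing.norm_star_mul_self, e]
      refine norm_cfc_le (by norm_num) fun t _ => ?_
      have e2 : f t * t * f t = 4 * t / (1 + t ^ 2) ^ 2 := by
        simp only [f]; field_simp; ring
      rw [e2, Real.norm_eq_abs, abs_le, le_div_iff₀ (by positivity), div_le_iff₀ (by positivity)]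
      -- Both bounds come from `|t| ≤ 1 + t ^ 2 ≤ (1 + t ^ 2) ^ 2`.
      constructor <;> nlinarith [sq_nonneg (t - 1), sq_nonneg (t + 1), sq_nonneg (t ^ 2)]
    nlinarith [norm_nonneg (x * cfc f (star x * x))]
  · have e : cfc g (star x * x) * (star x * x - 1) = 1 - cfc f (star x * x) := by
      have h1 : star x * x - 1 = cfc (fun t : ℝ => t - 1) (star x * x) := by
        rw [cfc_sub _ _ _ (by fun_prop) (by fun_prop), cfc_id' ℝ (star x * x), cfc_const_one ℝ (star x * x)]
      conv_lhs => rw [h1, ← cfc_mul g _ _ (by fun_prop) (by fun_prop)]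
      rw [← cfc_const_one ℝ (star x * x), ← cfc_sub _ _ _ (by fun_prop) (by fun_prop)]
      congr 1
      funext t
      simp only [f, g]
      have := hd t
      field_simp
      ring
    rw [mul_assoc, e, mul_sub, mul_one]

/-- An open neighbourhood of `a` is also a neighbourhood of each `c n` it contains, so no uniformity
in `n` is needed. -/
theorem Filter.tendsto_bind_nhds {α β X : Type*} [TopologicalSpace X] {l : Filter α}
    {m : α → Filter β} {f : β → X} {c : α → X} {a : X} (h : ∀ n, Tendsto f (m n) (𝓝 (c n)))
    (hc : Tendsto c l (𝓝 a)) : Tendsto f (l.bind m) (𝓝 a) := by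
  refine tendsto_nhds.2 fun s hs ha => ?_
  rw [mem_bind']
  filter_upwards [hc.eventually (hs.mem_nhds ha)] with n hn
  exact h n (hs.mem_nhds hn)

/-! ### Unitaries of a tracial ultrapower -/

namespace TracialState

variable {A : Type*} [CStarAlgebra A] (τ : TracialState A)

theorem tendsto_norm₂_iff {l : Filter ℕ} {x : ℕ → A} :
    Tendsto (fun n => τ.norm₂ (x n)) l (𝓝 0) ↔
      Tendsto (fun n => τ (star (x n) * x n)) l (𝓝 0) := by
  simp_rw [← norm₂_sq]
  constructor
  · intro h
    simpa [Function.comp_def] using (Complex.continuous_ofReal.tendsto _).comp (h.pow 2)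
  · intro h
    have h2 := ((Complex.continuous_re.tendsto _).comp h).sqrt
    simpa [Function.comp_def, ← Complex.ofReal_pow, Real.sqrt_sq (τ.norm₂_nonneg _)] using h2

namespace Ultrapower

variable [Nontrivial A] (ω : Ultrafilter ℕ)

/-- Bounded scalar sequences converge along an ultrafilter by compactness, so the `limUnder`
defining `trace` is a genuine limit. -/
theorem tendsto_trace (x : lp (fun _ : ℕ => A) ∞) :
    Tendsto (fun n => τ (x n)) ω (𝓝 (trace τ ω (mk τ ω x))) := by
  have hK := isCompact_closedBall (0 : ℂ) (‖τ.toCLM‖ * ‖x‖)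
  obtain ⟨c, -, hc⟩ := hK.ultrafilter_le_nhds (ω.map fun n => τ (x n)) (by
    rw [le_principal_iff]
    have h : ∀ᶠ n in (ω : Filter ℕ), τ (x n) ∈ Metric.closedBall (0 : ℂ) (‖τ.toCLM‖ * ‖x‖) :=
      Eventually.of_forall fun n => by
        rw [mem_closedBall_zero_iff]
        refine (τ.toCLM.le_opNorm _).trans ?_
        gcongr
        exact lp.norm_apply_le_norm ENNReal.top_ne_zero x n
    exact h)
  exact tendsto_nhds_limUnder ⟨c, hc⟩

/-- A unitary of the ultrapower with trace `1` is trivial. -/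
theorem eq_one_of_trace_eq_one {a : τ.Ultrapower ω} (ha : star a * a = 1)
    (h : trace τ ω a = 1) : a = 1 := by
  obtain ⟨x, rfl⟩ := mk_surjective τ ω a
  rw [← _root_.map_one (mk τ ω), mk_eq_mk_iff, tendsto_norm₂_iff]
  have h1 := tendsto_trace τ ω x
  have h2 := tendsto_trace τ ω (star x * x)
  have h3 := (continuous_star.tendsto _).comp h1
  have ht1 : trace τ ω 1 = 1 := by
    have := tendsto_trace τ ω 1
    rw [_root_.map_one] at this
    refine tendsto_nhds_unique this ?_
    simp [τ.map_one]
  rw [map_mul, ← star_mk, ha, ht1] at h2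
  rw [h] at h1 h3
  -- `τ((x - 1)* (x - 1)) = τ(x* x) - τ(x) - conj τ(x) + 1`, which tends to `1 - 1 - 1 + 1 = 0`.
  have h4 := ((h2.sub h1).sub h3).add_const 1
  simp only [star_one, sub_self, zero_sub, neg_add_cancel] at h4
  refine h4.congr fun n => ?_
  have e := τ.conj_symm 1 (x n)
  have e' := τ.conj_symm (x n) 1
  simp only [star_one, one_mul, mul_one] at e e'
  simp [sub_mul, mul_sub, ← e', τ.map_one]
  ring

/-- Every unitary of the ultrapower lifts to a sequence of norm at most `2`. -/
theorem exists_norm_le_two_mk_eq {a : τ.Ultrapower ω} (ha : star a * a = 1) :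
    ∃ x : lp (fun _ : ℕ => A) ∞, ‖x‖ ≤ 2 ∧ mk τ ω x = a := by
  obtain ⟨x, rfl⟩ := mk_surjective τ ω a
  -- Bounded sequences form a C*-algebra, so the functional calculus applies to the whole sequence
  -- `x` at once.
  let _ : CStarAlgebra (lp (fun _ : ℕ => A) ∞) := { }
  obtain ⟨y, c, hy, h⟩ := exists_norm_le_two_sub_eq_mul x
  refine ⟨y, hy, ?_⟩
  have h1 := congrArg (mk τ ω) h
  rw [map_mul, map_sub, map_sub, map_mul, ← star_mk, ha, _root_.map_one, sub_self, mul_zero,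
    sub_eq_zero] at h1
  exact h1.symm

/-! ### Iterated ultrafilters and gluing of ultrapowers -/

/-- The ultrafilter `{S | {n | {k | (n, k) ∈ S} ∈ ν n} ∈ ω}`, transported to `ℕ` along the
pairing function. -/
def _root_.Ultrafilter.iterate (ω : Ultrafilter ℕ) (ν : ℕ → Ultrafilter ℕ) : Ultrafilter ℕ :=
  ω.bind fun n => (ν n).map (Nat.pair n)

theorem _root_.Ultrafilter.tendsto_iterate {X : Type*} [TopologicalSpace X]
    {ω : Ultrafilter ℕ} {ν : ℕ → Ultrafilter ℕ} {f : ℕ → X} {c : ℕ → X} {a : X}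
    (h : ∀ n, Tendsto (fun k => f (Nat.pair n k)) (ν n) (𝓝 (c n))) (hc : Tendsto c ω (𝓝 a)) :
    Tendsto f (ω.iterate ν) (𝓝 a) :=
  Filter.tendsto_bind_nhds (fun n => tendsto_map'_iff.2 (h n)) hc

/-- A finite set meets each row in a finite set. Freeness comes from the rows alone, so `ω` may be
principal. -/
theorem _root_.Ultrafilter.iterate_le_cofinite {ω : Ultrafilter ℕ} {ν : ℕ → Ultrafilter ℕ}
    (h : ∀ n, (ν n : Filter ℕ) ≤ cofinite) : (ω.iterate ν : Filter ℕ) ≤ cofinite := by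
  intro s hs
  refine mem_bind'.2 (Eventually.of_forall fun n => h n ?_)
  exact Set.Finite.preimage (fun a _ b _ hab => (Nat.pair_eq_pair.1 hab).2) hs

variable {τ} {ν : ℕ → Ultrafilter ℕ}

/-- The row limits of the `2`-norm of the difference are all `0`, hence so is the iterated limit.
Every algebraic identity for glued sequences is checked this way. -/
theorem mk_iterate_eq {x y : lp (fun _ : ℕ => A) ∞} {x' y' : ℕ → lp (fun _ : ℕ => A) ∞}
    (hx : ∀ n k, x' n k = x (Nat.pair n k)) (hy : ∀ n k, y' n k = y (Nat.pair n k))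
    (h : ∀ n, mk τ (ν n) (x' n) = mk τ (ν n) (y' n)) :
    mk τ (ω.iterate ν) x = mk τ (ω.iterate ν) y := by
  rw [mk_eq_mk_iff]
  refine Ultrafilter.tendsto_iterate (fun n => ?_) tendsto_const_nhds
  simpa only [hx, hy] using (mk_eq_mk_iff τ (ν n)).1 (h n)

theorem exists_lift_of_unitary (u : ∀ n, unitary (τ.Ultrapower (ν n))) :
    ∃ (x : lp (fun _ : ℕ => A) ∞) (x' : ℕ → lp (fun _ : ℕ => A) ∞),
      (∀ n k, x' n k = x (Nat.pair n k)) ∧ ∀ n, mk τ (ν n) (x' n) = u n := by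
  choose x' hx' hmk using fun n => exists_norm_le_two_mk_eq τ (ν n) (u n).2.1
  -- The rows form one bounded sequence because the bound `2` is the same for every `n`.
  refine ⟨⟨fun k => x' k.unpair.1 k.unpair.2, memℓp_infty ⟨2, ?_⟩⟩, x', fun n k => ?_, hmk⟩
  · rintro _ ⟨k, rfl⟩
    exact (lp.norm_apply_le_norm ENNReal.top_ne_zero _ _).trans (hx' _)
  · simp

/-- An ultraproduct of unitary groups of tracial ultrapowers maps, compatibly with the traces, to
the unitary group of one tracial ultrapower. -/
theorem exists_monoidHom_iterate (τ : TracialState A) (ν : ℕ → Ultrafilter ℕ) :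
    ∃ Θ : (∀ n, unitary (τ.Ultrapower (ν n))) →* unitary (τ.Ultrapower (ω.iterate ν)),
      ∀ u c, Tendsto (fun n => trace τ (ν n) (u n)) ω (𝓝 c) →
        trace τ (ω.iterate ν) (Θ u) = c := by
  -- The chosen lift `x u` need not be multiplicative in `u`; only its class is.
  choose x x' hx hmk using exists_lift_of_unitary (τ := τ) (ν := ν)
  have h1 : mk τ (ω.iterate ν) (x 1) = 1 := by
    rw [← _root_.map_one (mk τ (ω.iterate ν))]
    refine mk_iterate_eq ω (y' := 1) (hx 1) (fun _ _ => rfl) fun n => ?_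
    rw [hmk]
    simp
  have hmul : ∀ u v, mk τ (ω.iterate ν) (x (u * v)) =
      mk τ (ω.iterate ν) (x u) * mk τ (ω.iterate ν) (x v) := fun u v => by
    rw [← map_mul]
    refine mk_iterate_eq ω (y' := x' u * x' v) (hx _) (fun n k => ?_) fun n => ?_
    · simp [hx]
    · simp [hmk]
  have hstar : ∀ u, star (mk τ (ω.iterate ν) (x u)) = mk τ (ω.iterate ν) (x u⁻¹) := fun u => by
    rw [star_mk]
    refine mk_iterate_eq ω (x' := star (x' u)) (fun n k => ?_) (hx _) fun n => ?_
    · simp [hx]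
    · rw [Pi.star_apply, ← star_mk, hmk, hmk]
      -- In a unitary group the inverse is the adjoint.
      rfl
  refine ⟨
    { toFun := fun u => ⟨mk τ (ω.iterate ν) (x u), ?_, ?_⟩
      map_one' := Subtype.ext h1
      map_mul' := fun u v => Subtype.ext (hmul u v) }, fun u c hc => ?_⟩
  · rw [hstar, ← hmul, inv_mul_cancel, h1]
  · rw [hstar, ← hmul, mul_inv_cancel, h1]
  · refine tendsto_nhds_unique (tendsto_trace τ (ω.iterate ν) (x u)) ?_
    refine Ultrafilter.tendsto_iterate (fun n => ?_) hc
    simpa only [hx, hmk] using tendsto_trace τ (ν n) (x' u n)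

end Ultrapower

end TracialState

/-! ### Passage to the quotient by `N` -/

theorem mainTheorem2 (P : ℕ → CentralPair.{u}) (hP : ∀ n, (P n).IsHyperlinear)
    (ω : Ultrafilter ℕ) : (CentralPair.ultraproduct P ω).IsHyperlinear := by
  choose ν hν θ hθ using hP
  obtain ⟨Θ, hΘ⟩ :=
    TracialState.Ultrapower.exists_monoidHom_iterate ω hyperfiniteTrace ν
  let ψ : (∀ n, (P n).carrier) →* unitary (hyperfiniteTrace.Ultrapower (ω.iterate ν)) :=
    Θ.comp (MonoidHom.pi fun n => (θ n).comp (Pi.evalMonoidHom _ n))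
  -- Used twice: with `c = 1` it puts `N` in the kernel of `ψ`, and with the limit function as `c`
  -- it gives the trace formula on the quotient.
  have hψ : ∀ g c, Tendsto (fun n => (P n).φ (g n)) ω (𝓝 c) →
      TracialState.Ultrapower.trace hyperfiniteTrace (ω.iterate ν) (ψ g) = c := fun g c hc =>
    hΘ _ c (hc.congr fun n => (hθ n (g n)).symm)
  have hN : ∀ g ∈ CentralPair.nullSubgroup P ω, ψ g = 1 := fun g hg =>
    Subtype.ext (TracialState.Ultrapower.eq_one_of_trace_eq_one _ _ (ψ g).2.1 (hψ g 1 hg))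
  refine ⟨ω.iterate ν, Ultrafilter.iterate_le_cofinite hν,
    QuotientGroup.lift (CentralPair.nullSubgroup P ω) ψ hN, fun a => ?_⟩
  obtain ⟨g, rfl⟩ := QuotientGroup.mk'_surjective (CentralPair.nullSubgroup P ω) a
  have h1 := hψ g _ (CentralPair.tendsto_limitFunction P ω g)
  have h2 : QuotientGroup.lift (CentralPair.nullSubgroup P ω) ψ hN
      (QuotientGroup.mk' (CentralPair.nullSubgroup P ω) g) = ψ g := QuotientGroup.lift_mk' _ hN g
  rw [← h2] at h1
  exact h1
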